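/- There is an absolute constant $C>0$ such that the following holds for all real numbers $\rho_y,\rho_n\ge 0$ with $\rho_y+\rho_n<1$ and all $\delta\in(0,1)$. A quantum decision algorithm on $n$ qubits is given by an initial $n$-qubit state $|\mathrm{in}_x\rangle$ for every input $x$ in a set $X$ (a unit vector; the initial states of any two inputs are equal or orthogonal, which covers inputs given as oracles, with one fixed initial state, and inputs given as computational basis states), a unitary operator $\mathcal{A}_x$ on the $n$ qubits, and an output qubit. On input $x$ it applies $\mathcal{A}_x$ to $|\mathrm{in}_x\rangle$ and measures the output qubit in the computational basis; the outcome $1$ means "yes" and $0$ means "no". It has error at most $(\rho_y,\rho_n)$ on sets of yes-inputs and no-inputs in $X$ if it answers "no" with probability at most $\rho_y$ on every yes-input and "yes" with probability at most $\rho_n$ on every no-input. For any choice of $n$, $X$, initial states and output qubit, there are a number $a$ of ancillary qubits and a black-box program on $n+a$ qubits, that is, a finite sequence of fixed unitary operators on all $n+a$ qubits, calls to a black box $\mathcal{A}$ acting on the first $n$ qubits, and calls to its adjoint $\mathcal{A}^\dagger$, such that 1. the program makes in total at most $$C\cdot\frac{1}{\sqrt{1-\rho_y}-\sqrt{\rho_n}}\,\log\frac1\delta$$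 calls to $\mathcal{A}$ and $\mathcal{A}^\dagger$; 2. for every choice of sets of yes-inputs and no-inputs in $X$ and of unitary operators $(\mathcal{A}_x)_{x\in X}$ for which the given algorithm has error at most $(\rho_y,\rho_n)$, the algorithm which on input $x$ starts in $|\mathrm{in}_x\rangle\otimes|0^a\rangle$, runs the program with $\mathcal{A}=\mathcal{A}_x$, and measures the same output qubit has error at most $(\delta,\delta)$. -/

import Mathlib

open scoped Matrix Kronecker

noncomputable section

namespace QDecision

/-- State vectors of a register whose qubits are labelled by `Q`, in coordinates with respect to
the computational basis `Q → Bool`. -/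
abbrev State (Q : Type) : Type := (Q → Bool) → ℂ

/-- Unitary operators on the register `Q`. -/
abbrev Gate (Q : Type) [Fintype Q] [DecidableEq Q] : Type := Matrix.unitaryGroup (Q → Bool) ℂ

variable {X : Type*} {Q R : Type} [Fintype Q] [DecidableEq Q] [Fintype R] [DecidableEq R]

/-- The state `|0 ⋯ 0⟩`. -/
def zeroState (R : Type) [Fintype R] [DecidableEq R] : State R := Pi.single (fun _ => false) 1

/-- The product state `ψ ⊗ φ` of two registers. -/
def tensor (ψ : State Q) (φ : State R) : State (Q ⊕ R) :=
  fun z => ψ (fun i => z (Sum.inl i)) * φ (fun j => z (Sum.inr j))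

/-- The operator `U ⊗ 1` on the joint register: `U` acts on `Q`, nothing happens to `R`. -/
def extend (R : Type) [Fintype R] [DecidableEq R] (U : Gate Q) : Gate (Q ⊕ R) :=
  ⟨Matrix.reindexAlgEquiv ℂ ℂ (Equiv.sumArrowEquivProdArrow Q R Bool).symm
      ((U : Matrix (Q → Bool) (Q → Bool) ℂ) ⊗ₖ (1 : Matrix (R → Bool) (R → Bool) ℂ)), by
    have h := Matrix.kronecker_mem_unitary U.2
      (one_mem (Matrix.unitaryGroup (R → Bool) ℂ))
    rw [Matrix.mem_unitaryGroup_iff] at h ⊢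
    have hs : ∀ M : Matrix ((Q → Bool) × (R → Bool)) ((Q → Bool) × (R → Bool)) ℂ,
        star (Matrix.reindexAlgEquiv ℂ ℂ (Equiv.sumArrowEquivProdArrow Q R Bool).symm M) =
          Matrix.reindexAlgEquiv ℂ ℂ (Equiv.sumArrowEquivProdArrow Q R Bool).symm (star M) :=
      fun M => rfl
    rw [hs, ← map_mul, h, map_one]⟩

theorem tensor_dotProduct (ψ ψ' : State Q) (φ φ' : State R) :
    star (tensor ψ φ) ⬝ᵥ tensor ψ' φ' = (star ψ ⬝ᵥ ψ') * (star φ ⬝ᵥ φ') := by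
  simp only [dotProduct, Finset.sum_mul_sum, tensor, Pi.star_apply, star_mul']
  rw [← Finset.sum_product', Finset.univ_product_univ,
    ← (Equiv.sumArrowEquivProdArrow Q R Bool).sum_comp]
  refine Finset.sum_congr rfl fun z _ => ?_
  simp only [Equiv.sumArrowEquivProdArrow, Equiv.coe_fn_mk, Function.comp_def]
  ring

/-- What a decision algorithm on the register `Q` is run on and how it is observed: the initial
state for every input `x : X`, and the output qubit, whose value `true` means "yes".

Initial states of different inputs are either the same or orthogonal. This covers inputs that are
given as oracles (one fixed initial state) and inputs that are given as computational basis
states, with or without ancillary qubits in a fixed state. -/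
structure Interface (X : Type*) (Q : Type) [Fintype Q] [DecidableEq Q] where
  out : Q
  input : X → State Q
  input_unit : ∀ x, star (input x) ⬝ᵥ input x = 1
  input_orth : ∀ x y, input x = input y ∨ star (input x) ⬝ᵥ input y = 0

/-- The same input states and the same output qubit, next to ancillary qubits in the state
`|0 ⋯ 0⟩`. -/
def Interface.withAncilla (I : Interface X Q) (R : Type) [Fintype R] [DecidableEq R] :
    Interface X (Q ⊕ R) where
  out := Sum.inl I.out
  input x := tensor (I.input x) (zeroState R)
  input_unit x := by
    rw [tensor_dotProduct, I.input_unit]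
    simp [zeroState]
  input_orth x y := by
    rcases I.input_orth x y with h | h
    · left; rw [h]
    · right; rw [tensor_dotProduct, h, zero_mul]

/-- The probability that the output qubit is observed in the state `b`, after the unitary
operator `A` was applied to the initial state for the input `x`. -/
def Interface.outcomeProb (I : Interface X Q) (A : Gate Q) (x : X) (b : Bool) : ℝ :=
  ∑ z : Q → Bool with z I.out = b,
    ‖((A : Matrix (Q → Bool) (Q → Bool) ℂ) *ᵥ I.input x) z‖ ^ 2

/-- The quantum decision algorithm that applies the operator `A x` on input `x` has error at most
`ρy` on yes-inputs and at most `ρn` on no-inputs. -/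
def Interface.HasError (I : Interface X Q) (A : X → Gate Q) (yes no : Set X) (ρy ρn : ℝ) : Prop :=
  (∀ x ∈ yes, I.outcomeProb (A x) x false ≤ ρy) ∧ (∀ x ∈ no, I.outcomeProb (A x) x true ≤ ρn)

/-- One step of a program with black-box access to an operator on `Q`: a fixed unitary operator on
the whole register, a call to the black box, or a call to its adjoint. -/
inductive Step (Q R : Type) [Fintype Q] [DecidableEq Q] [Fintype R] [DecidableEq R] : Type
  | gate (U : Gate (Q ⊕ R)) : Step Q R
  | call : Step Q R
  | callAdjoint : Step Q R

/-- The operator that a step applies when the black box is `A`. -/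
def Step.eval (A : Gate Q) : Step Q R → Gate (Q ⊕ R)
  | .gate U => U
  | .call => extend R A
  | .callAdjoint => extend R (star A)

/-- The number of calls (to `A` or to `A†`) that a step makes. -/
def Step.cost : Step Q R → ℕ
  | .gate _ => 0
  | .call => 1
  | .callAdjoint => 1

/-- A black-box program: its steps, from the first to the last. -/
abbrev Program (Q R : Type) [Fintype Q] [DecidableEq Q] [Fintype R] [DecidableEq R] : Type :=
  List (Step Q R)

/-- The operator that a program applies when the black box is `A`. -/
def Program.run (A : Gate Q) : Program Q R → Gate (Q ⊕ R)
  | [] => 1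
  | s :: p => Program.run A p * s.eval A

/-- The total number of calls to `A` and `A†` that a program makes. -/
def Program.calls (p : Program Q R) : ℕ := (p.map Step.cost).sum

end QDecision

end

open scoped Matrix Kronecker ComplexOrder

noncomputable section

namespace QDecision

/-! Let `ψ` be the initial state and `p` the acceptance probability of `A` on it. The amplitude
amplification iterate `W = (2|ψ⟩⟨ψ| - 1) A† S A`, where `S` negates the accepting basis states, acts
on `ψ` inside a space of dimension at most two. There `ψ` is a sum of two orthogonal eigenvectors
whose eigenvalues lie at distance exactly `2√p` from `1` (`exists_eigenvectors_amplify`). Deciding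
between `p ≥ 1 - ρy` and `p ≤ ρn` thus means locating an eigenvalue on the unit circle with
precision `Δ = √(1 - ρy) - √ρn`.

Phase estimation does this: `W ^ k` is applied in superposition over `k < N` with amplitudes `α k`,
and the counter is Fourier transformed and observed. No repetition or majority vote is needed,
because a good window `α` makes distant outcomes exponentially unlikely. It consists of the
normalised coefficients of `(1 + X + ⋯ + X^(m-1))^(r+1)`, whose transform is a power of a Dirichlet
kernel. The probability of an outcome farther than `Δ` is then at most `(r + 1) (2 / (Δ m))^(2r)`
(`exists_window`), so `m` of order `1 / Δ` and `r` of order `log (1 / δ)` suffice.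

The reflection about `ψ` depends on the input, while the gates of a program are fixed. Since initial
states are equal or orthogonal, they belong to one orthonormal basis. The label of the initial state
in this basis is copied to ancillas, and the reflection is controlled by that label
(`exists_program_outcomeProb`). -/

/-! ### The Fourier transform of order `N` -/

/-- The `N`-th roots of unity. -/
def root (N : ℕ) (j : Fin N) : ℂ := Complex.exp (2 * Real.pi * Complex.I / N) ^ (j : ℕ)

theorem norm_root {N : ℕ} (j : Fin N) : ‖root N j‖ = 1 := by
  have hN : N ≠ 0 := by have := j.2; omega
  rw [root, norm_pow, (Complex.isPrimitiveRoot_exp N hN).norm'_eq_one hN, one_pow]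

/-- The matrix of the Fourier transform of order `N`. -/
def fourierMatrix (N : ℕ) : Matrix (Fin N) (Fin N) ℂ :=
  fun j k => ((√N : ℝ) : ℂ)⁻¹ * star (root N j) ^ (k : ℕ)

theorem fourierMatrix_mem_unitaryGroup (N : ℕ) :
    fourierMatrix N ∈ Matrix.unitaryGroup (Fin N) ℂ := by
  rw [Matrix.mem_unitaryGroup_iff]
  ext j j'
  have hN : N ≠ 0 := by have := j.2; omega
  have hN' : (N : ℂ) ≠ 0 := by exact_mod_cast hN
  have hζ := Complex.isPrimitiveRoot_exp N hN
  set x : ℂ := star (root N j) * root N j' with hx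
  have hsq : ((√N : ℝ) : ℂ)⁻¹ * ((√N : ℝ) : ℂ)⁻¹ = (N : ℂ)⁻¹ := by
    rw [← mul_inv, ← Complex.ofReal_mul, Real.mul_self_sqrt (Nat.cast_nonneg N)]
    simp
  have hsum : (fourierMatrix N * star (fourierMatrix N)) j j' =
      (N : ℂ)⁻¹ * ∑ k ∈ Finset.range N, x ^ k := by
    rw [Matrix.mul_apply, Finset.mul_sum, ← Fin.sum_univ_eq_sum_range
      (fun k => (N : ℂ)⁻¹ * x ^ k)]
    refine Finset.sum_congr rfl fun k _ => ?_
    simp only [Matrix.star_apply, fourierMatrix, star_mul', star_pow, star_star, star_inv₀]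
    rw [← hsq, hx, mul_pow, show star (((√N : ℝ) : ℂ)) = ((√N : ℝ) : ℂ) from
      Complex.conj_ofReal _]
    ring
  have hunit : star (root N j) * root N j = 1 := by
    have := Complex.conj_mul' (root N j)
    rw [norm_root] at this
    simpa using this
  rw [hsum]
  by_cases h : j = j'
  · subst h
    rw [hx, hunit]
    simp [hN']
  · have hrootN : ∀ i : Fin N, root N i ^ N = 1 := fun i => by
      rw [root, ← pow_mul, mul_comm (i : ℕ), pow_mul, hζ.pow_eq_one, one_pow]
    have hxN : x ^ N = 1 := by
      rw [hx, mul_pow, ← star_pow, hrootN, hrootN]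
      simp
    have hx1 : x ≠ 1 := by
      intro h1
      apply h
      have h2 : root N j = root N j' := by
        calc root N j = root N j * x := by rw [h1, mul_one]
          _ = (star (root N j) * root N j) * root N j' := by rw [hx]; ring
          _ = root N j' := by rw [hunit, one_mul]
      exact Fin.ext (hζ.pow_inj j.2 j'.2 h2)
    have : ∑ k ∈ Finset.range N, x ^ k = 0 := by
      rw [geom_sum_eq hx1, hxN]; simp
    rw [this, Matrix.one_apply_ne h, mul_zero]

section Norm
variable {ι : Type*} [Fintype ι]

theorem sum_norm_sq_eq_dotProduct (w : ι → ℂ) : ((∑ i, ‖w i‖ ^ 2 : ℝ) : ℂ) = star w ⬝ᵥ w := by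
  simp only [dotProduct, Pi.star_apply]
  push_cast
  exact Finset.sum_congr rfl fun i _ => (Complex.conj_mul' _).symm

variable [DecidableEq ι]

theorem star_mulVec_dotProduct_mulVec {W : Matrix ι ι ℂ} (hW : W ∈ Matrix.unitaryGroup ι ℂ)
    (v w : ι → ℂ) : star (W *ᵥ v) ⬝ᵥ (W *ᵥ w) = star v ⬝ᵥ w := by
  rw [Matrix.star_mulVec, Matrix.dotProduct_mulVec, Matrix.vecMul_vecMul,
    ← Matrix.star_eq_conjTranspose, Matrix.mem_unitaryGroup_iff'.1 hW, Matrix.vecMul_one]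

theorem sum_norm_sq_mulVec {U : Matrix ι ι ℂ} (hU : U ∈ Matrix.unitaryGroup ι ℂ) (v : ι → ℂ) :
    ∑ i, ‖(U *ᵥ v) i‖ ^ 2 = ∑ i, ‖v i‖ ^ 2 := by
  apply Complex.ofReal_injective
  rw [sum_norm_sq_eq_dotProduct, sum_norm_sq_eq_dotProduct, star_mulVec_dotProduct_mulVec hU]

end Norm

/-! ### Windows for phase estimation -/

theorem norm_geom_sum_mul_le {x : ℂ} (hx : ‖x‖ = 1) (m : ℕ) :
    ‖∑ i ∈ Finset.range m, x ^ i‖ * ‖1 - x‖ ≤ 2 := by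
  rw [← norm_mul, geom_sum_mul_neg]
  calc ‖1 - x ^ m‖ ≤ ‖(1 : ℂ)‖ + ‖x ^ m‖ := norm_sub_le _ _
    _ = 2 := by rw [norm_pow, hx]; norm_num

/-- The amplitude of the `j`-th outcome of phase estimation with window `α`, for the eigenvalue
`lam`. -/
def estimate {N : ℕ} (α : Fin N → ℂ) (lam : ℂ) (j : Fin N) : ℂ :=
  ∑ k, fourierMatrix N j k * α k * lam ^ (k : ℕ)

/-- Turns products of window polynomials into products of amplitudes, so that powers of a kernel can
be estimated factor by factor. -/
theorem estimate_eq_eval {N : ℕ} (P : Polynomial ℂ) (hP : P.natDegree < N) (lam : ℂ)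
    (j : Fin N) :
    estimate (fun k => P.coeff k) lam j =
      ((√N : ℝ) : ℂ)⁻¹ * P.eval (star (root N j) * lam) := by
  rw [Polynomial.eval_eq_sum_range' hP, estimate, Finset.mul_sum,
    ← Fin.sum_univ_eq_sum_range
      (fun k => ((√N : ℝ) : ℂ)⁻¹ * (P.coeff k * (star (root N j) * lam) ^ k))]
  refine Finset.sum_congr rfl fun k _ => ?_
  rw [fourierMatrix, mul_pow]
  ring

/-- Parseval: multiplication by the phases `lam ^ k` does not change the norm of the window. -/
theorem sum_norm_sq_estimate {N : ℕ} (α : Fin N → ℂ) {lam : ℂ} (hlam : ‖lam‖ = 1) :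
    ∑ j, ‖estimate α lam j‖ ^ 2 = ∑ k, ‖α k‖ ^ 2 := by
  have h := sum_norm_sq_mulVec (fourierMatrix_mem_unitaryGroup N)
    (fun k => α k * lam ^ (k : ℕ))
  simp only [norm_mul, norm_pow, hlam, one_pow, mul_one] at h
  rw [← h]
  refine Finset.sum_congr rfl fun j _ => ?_
  simp only [estimate, Matrix.mulVec, dotProduct, mul_assoc]

open Polynomial in
-- Of the `r + 1` kernel factors, `r` are bounded pointwise by `2 / Δ` away from `lam`, and the last
-- is summed over all outcomes by Parseval. Normalisation supplies the powers of `m` in the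
-- denominator.
theorem exists_window {m : ℕ} (hm : 1 ≤ m) (r : ℕ) :
    ∃ α : Fin (m * (r + 1)) → ℂ, ∑ k, ‖α k‖ ^ 2 = 1 ∧
      ∀ (lam : ℂ) (Δ : ℝ) (J : Finset (Fin (m * (r + 1)))), ‖lam‖ = 1 → 0 < Δ →
        (∀ j ∈ J, Δ ≤ ‖root _ j - lam‖) →
        ∑ j ∈ J, ‖estimate α lam j‖ ^ 2 ≤ (r + 1) * (2 / (Δ * m)) ^ (2 * r) := by
  set N := m * (r + 1) with hN
  have hmN : m ≤ N := by rw [hN]; exact Nat.le_mul_of_pos_right m (Nat.succ_pos r)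
  have hm0 : (0 : ℝ) < m := by exact_mod_cast hm
  have hN0 : (0 : ℝ) < N := by exact_mod_cast lt_of_lt_of_le hm hmN
  set G : ℂ[X] := ∑ i ∈ Finset.range m, X ^ i with hG
  have hGdeg : G.natDegree ≤ m - 1 := natDegree_sum_le_of_forall_le _ _ fun i hi => by
    rw [natDegree_X_pow]; have := Finset.mem_range.1 hi; omega
  have hGeval : ∀ x, G.eval x = ∑ i ∈ Finset.range m, x ^ i := fun x => by
    simp [hG, eval_finsetSum]
  set P : ℂ[X] := G ^ (r + 1) with hP
  have hPdeg : P.natDegree < N := by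
    calc P.natDegree ≤ (r + 1) * (m - 1) := natDegree_pow_le_of_le _ hGdeg
      _ < (r + 1) * m := Nat.mul_lt_mul_of_pos_left (by omega) (Nat.succ_pos r)
      _ = N := by rw [hN, mul_comm]
  set S : ℝ := ∑ k : Fin N, ‖P.coeff k‖ ^ 2 with hS
  -- Cauchy–Schwarz over the `N` coefficients of `P`, whose sum is `P(1) = m^(r+1)`.
  have hSN : (m : ℝ) ^ (2 * (r + 1)) ≤ N * S := by
    have h1 : ((m : ℂ)) ^ (r + 1) = ∑ k : Fin N, P.coeff k := by
      have := eval_eq_sum_range' hPdeg 1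
      rw [hP, eval_pow, hGeval] at this
      simp only [one_pow, mul_one, Finset.sum_const, Finset.card_range, nsmul_eq_mul] at this
      rw [this, ← Fin.sum_univ_eq_sum_range (fun k => P.coeff k)]
    have h2 : (m : ℝ) ^ (r + 1) ≤ ∑ k : Fin N, ‖P.coeff k‖ := by
      calc (m : ℝ) ^ (r + 1) = ‖(m : ℂ) ^ (r + 1)‖ := by simp
        _ ≤ _ := by rw [h1]; exact norm_sum_le _ _
    calc (m : ℝ) ^ (2 * (r + 1)) = ((m : ℝ) ^ (r + 1)) ^ 2 := by rw [← pow_mul, mul_comm]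
      _ ≤ (∑ k : Fin N, ‖P.coeff k‖) ^ 2 := by gcongr
      _ ≤ _ := by
        have := sq_sum_le_card_mul_sum_sq (s := Finset.univ) (f := fun k : Fin N => ‖P.coeff k‖)
        simpa using this
  have hS0 : 0 < S := by
    have : 0 < N * S := lt_of_lt_of_le (by positivity) hSN
    exact pos_of_mul_pos_right this hN0.le
  have hGS : ∑ k : Fin N, ‖G.coeff k‖ ^ 2 = m := by
    have hc : ∀ k, G.coeff k = if k < m then 1 else 0 := fun k => by
      simp [hG, coeff_X_pow]
    simp only [hc]
    rw [Fin.sum_univ_eq_sum_range (fun k => ‖(if k < m then 1 else 0 : ℂ)‖ ^ 2) N]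
    rw [← Finset.sum_subset (Finset.range_mono hmN)]
    · rw [Finset.sum_congr rfl (g := fun _ => (1 : ℝ))]
      · simp
      · intro k hk
        simp [Finset.mem_range.1 hk]
    · intro k _ hk
      simp [mt Finset.mem_range.2 hk]
  refine ⟨fun k => ((√S : ℝ) : ℂ)⁻¹ * P.coeff k, ?_, ?_⟩
  · simp only [norm_mul, mul_pow, norm_inv, Complex.norm_real, Real.norm_eq_abs, inv_pow, sq_abs,
      Real.sq_sqrt hS0.le]
    rw [← Finset.mul_sum, ← hS, inv_mul_cancel₀ hS0.ne']
  · intro lam Δ J hlam hΔ hJ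
    have hest : ∀ j, estimate (fun k : Fin N => ((√S : ℝ) : ℂ)⁻¹ * P.coeff k) lam j =
        ((√S : ℝ) : ℂ)⁻¹ * estimate (fun k : Fin N => P.coeff k) lam j := fun j => by
      simp only [estimate, Finset.mul_sum]
      exact Finset.sum_congr rfl fun k _ => by ring
    -- One factor `G` is left unestimated here; bounding all `r + 1` pointwise would leave a sum
    -- over the outcomes.
    have hb : ∀ j ∈ J, ‖estimate (fun k : Fin N => P.coeff k) lam j‖ ^ 2 ≤
        (2 / Δ) ^ (2 * r) * ‖estimate (fun k : Fin N => G.coeff k) lam j‖ ^ 2 := by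
      intro j hj
      have hx : ‖star (root N j) * lam‖ = 1 := by rw [norm_mul, norm_star, norm_root, hlam, one_mul]
      have hd : Δ ≤ ‖1 - star (root N j) * lam‖ := by
        refine (hJ j hj).trans (le_of_eq ?_)
        have hu : root N j * star (root N j) = 1 := by
          have := Complex.mul_conj' (root N j)
          rw [norm_root] at this
          simpa using this
        calc ‖root N j - lam‖ = ‖root N j * (1 - star (root N j) * lam)‖ := by
              rw [mul_sub, mul_one, ← mul_assoc, hu, one_mul]
          _ = _ := by rw [norm_mul, norm_root, one_mul]
      have hg : ‖G.eval (star (root N j) * lam)‖ ≤ 2 / Δ := by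
        rw [le_div_iff₀ hΔ, hGeval]
        exact (mul_le_mul_of_nonneg_left hd (norm_nonneg _)).trans (norm_geom_sum_mul_le hx m)
      rw [estimate_eq_eval P hPdeg, estimate_eq_eval G (by omega), hP, eval_pow,
        norm_mul, norm_mul, norm_pow]
      have hg' : (‖G.eval (star (root N j) * lam)‖ ^ r) ^ 2 ≤ (2 / Δ) ^ (2 * r) := by
        rw [mul_comm 2 r, pow_mul]; gcongr
      calc _ = (‖G.eval (star (root N j) * lam)‖ ^ r) ^ 2 *
            (‖((√N : ℝ) : ℂ)⁻¹‖ * ‖G.eval (star (root N j) * lam)‖) ^ 2 := by ring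
        _ ≤ _ := by gcongr
    calc ∑ j ∈ J, ‖estimate (fun k : Fin N => ((√S : ℝ) : ℂ)⁻¹ * P.coeff k) lam j‖ ^ 2
        = S⁻¹ * ∑ j ∈ J, ‖estimate (fun k : Fin N => P.coeff k) lam j‖ ^ 2 := by
          rw [Finset.mul_sum]
          refine Finset.sum_congr rfl fun j _ => ?_
          rw [hest, norm_mul, mul_pow, norm_inv, Complex.norm_real, Real.norm_eq_abs, inv_pow,
            sq_abs, Real.sq_sqrt hS0.le]
      _ ≤ S⁻¹ * ((2 / Δ) ^ (2 * r) * m) := by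
          gcongr
          calc _ ≤ ∑ j ∈ J, (2 / Δ) ^ (2 * r) *
                  ‖estimate (fun k : Fin N => G.coeff k) lam j‖ ^ 2 := Finset.sum_le_sum hb
            _ ≤ ∑ j, (2 / Δ) ^ (2 * r) *
                  ‖estimate (fun k : Fin N => G.coeff k) lam j‖ ^ 2 :=
                Finset.sum_le_sum_of_subset_of_nonneg (Finset.subset_univ _)
                  fun j _ _ => by positivity
            _ = _ := by rw [← Finset.mul_sum, sum_norm_sq_estimate _ hlam, hGS]
      _ ≤ (r + 1) * (2 / (Δ * m)) ^ (2 * r) := by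
          rw [inv_mul_le_iff₀ hS0]
          have hNr : (N : ℝ) = m * (r + 1) := by rw [hN]; push_cast; ring
          rw [hNr] at hSN
          have e1 : (2 / Δ) ^ (2 * r) = (2 / (Δ * m)) ^ (2 * r) * (m : ℝ) ^ (2 * r) := by
            rw [← mul_pow]; congr 1; field_simp
          have e2 : (m : ℝ) ^ (2 * r) * m ≤ (r + 1) * S := by
            have : (m : ℝ) * ((m : ℝ) ^ (2 * r) * m) ≤ m * ((r + 1) * S) := by
              calc _ = (m : ℝ) ^ (2 * (r + 1)) := by ring
                _ ≤ _ := by linarith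
            exact le_of_mul_le_mul_left this hm0
          rw [e1, mul_assoc]
          calc _ ≤ (2 / (Δ * m)) ^ (2 * r) * ((r + 1) * S) := by gcongr
            _ = _ := by ring

/-! ### Spectrum of the amplitude amplification iterate -/

section Eigen
variable {ι : Type*} [Fintype ι]

theorem sum_norm_sq_add_of_orthogonal {v w : ι → ℂ} (h : star v ⬝ᵥ w = 0) (a b : ℂ) :
    ∑ i, ‖a * v i + b * w i‖ ^ 2 = ‖a‖ ^ 2 * ∑ i, ‖v i‖ ^ 2 + ‖b‖ ^ 2 * ∑ i, ‖w i‖ ^ 2 := by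
  have h' : star w ⬝ᵥ v = 0 := by
    rw [← star_star (star w ⬝ᵥ v), Matrix.star_dotProduct, star_star, h, star_zero]
  have e : (fun i => a * v i + b * w i) = a • v + b • w := rfl
  apply Complex.ofReal_injective
  rw [Complex.ofReal_add, Complex.ofReal_mul, Complex.ofReal_mul, sum_norm_sq_eq_dotProduct v,
    sum_norm_sq_eq_dotProduct w, sum_norm_sq_eq_dotProduct (fun i => a * v i + b * w i), e]
  simp only [star_add, star_smul, add_dotProduct, dotProduct_add, smul_dotProduct, dotProduct_smul,
    h, h', smul_eq_mul, mul_zero, add_zero, zero_add]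
  push_cast
  rw [← Complex.conj_mul', ← Complex.conj_mul']
  simp only [RCLike.star_def]
  ring

variable [DecidableEq ι]

/-- A unit vector `ψ` in a plane that is rotated by the unitary `W` is a sum of two orthogonal
eigenvectors of `W`. -/
theorem exists_eigenvectors {W : Matrix ι ι ℂ} (hW : W ∈ Matrix.unitaryGroup ι ℂ)
    {ψ : ι → ℂ} {c : ℝ} (hc : |c| ≤ 1) (hψ : star ψ ⬝ᵥ ψ = 1) (hψW : star ψ ⬝ᵥ (W *ᵥ ψ) = c)
    (hWW : W *ᵥ (W *ᵥ ψ) = (2 * c : ℂ) • (W *ᵥ ψ) - ψ) :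
    ∃ (v w : ι → ℂ) (l m : ℂ), ψ = v + w ∧ star v ⬝ᵥ w = 0 ∧ W *ᵥ v = l • v ∧ W *ᵥ w = m • w ∧
      ‖l‖ = 1 ∧ ‖m‖ = 1 ∧ ‖1 - l‖ ^ 2 = 2 - 2 * c ∧ ‖1 - m‖ ^ 2 = 2 - 2 * c := by
  have hc1 : 0 ≤ 1 - c ^ 2 := by
    have := (sq_le_one_iff_abs_le_one c).2 hc; linarith
  set s : ℝ := √(1 - c ^ 2) with hs
  have hs2 : s ^ 2 = 1 - c ^ 2 := Real.sq_sqrt hc1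
  set l : ℂ := ⟨c, s⟩ with hl
  set m : ℂ := ⟨c, -s⟩ with hm
  have hlm : l + m = 2 * c := by apply Complex.ext <;> simp [hl, hm]; ring
  have hlm1 : l * m = 1 := by
    apply Complex.ext
    · simp [hl, hm]; nlinarith
    · simp [hl, hm]; ring
  have nl : ‖l‖ = 1 := by
    rw [← sq_eq_sq₀ (norm_nonneg _) zero_le_one, ← Complex.normSq_eq_norm_sq, Complex.normSq_apply]
    simp only [hl]; nlinarith
  have nm : ‖m‖ = 1 := by
    rw [← sq_eq_sq₀ (norm_nonneg _) zero_le_one, ← Complex.normSq_eq_norm_sq, Complex.normSq_apply]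
    simp only [hm]; nlinarith
  have dl : ‖1 - l‖ ^ 2 = 2 - 2 * c := by
    rw [← Complex.normSq_eq_norm_sq, Complex.normSq_apply]
    simp [hl]; nlinarith
  have dm : ‖1 - m‖ ^ 2 = 2 - 2 * c := by
    rw [← Complex.normSq_eq_norm_sq, Complex.normSq_apply]
    simp [hm]; nlinarith
  -- In the degenerate case `c = ±1` and `l = m = c`. Then `‖Wψ - cψ‖² = 1 - c² = 0`, so `ψ` itself
  -- is an eigenvector.
  by_cases h0 : s = 0
  · have hcc : (c : ℂ) * c = 1 := by
      have : c * c = 1 := by rw [h0] at hs2; nlinarith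
      exact_mod_cast this
    have hlc : l = c := by apply Complex.ext <;> simp [hl, h0]
    have hWψ : W *ᵥ ψ = l • ψ := by
      have hψW' : star (W *ᵥ ψ) ⬝ᵥ ψ = c := by
        rw [← star_star (star (W *ᵥ ψ) ⬝ᵥ ψ), Matrix.star_dotProduct, star_star, hψW]
        exact Complex.conj_ofReal c
      have : star (W *ᵥ ψ - l • ψ) ⬝ᵥ (W *ᵥ ψ - l • ψ) = 0 := by
        rw [hlc]
        simp only [star_sub, star_smul, sub_dotProduct, dotProduct_sub, smul_dotProduct,
          dotProduct_smul, star_mulVec_dotProduct_mulVec hW, hψ, hψW, hψW', smul_eq_mul,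
          RCLike.star_def, Complex.conj_ofReal, hcc]
        ring
      exact sub_eq_zero.1 (dotProduct_star_self_eq_zero.1 this)
    exact ⟨ψ, 0, l, m, by simp, by simp, hWψ, by simp, nl, nm, dl, dm⟩
  · have hd : l - m ≠ 0 := by
      intro h
      apply h0
      have := congrArg Complex.im h
      simp [hl, hm] at this
      linarith
    have hv : W *ᵥ (W *ᵥ ψ - m • ψ) = l • (W *ᵥ ψ - m • ψ) := by
      rw [Matrix.mulVec_sub, Matrix.mulVec_smul, hWW, ← hlm, smul_sub, smul_smul, hlm1, add_smul,
        one_smul]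
      abel
    have hw : W *ᵥ (W *ᵥ ψ - l • ψ) = m • (W *ᵥ ψ - l • ψ) := by
      rw [Matrix.mulVec_sub, Matrix.mulVec_smul, hWW, ← hlm, smul_sub, smul_smul, mul_comm m l,
        hlm1, add_smul, one_smul]
      abel
    -- Unitarity gives `⟨v, w⟩ = m² ⟨v, w⟩`, and `m² ≠ 1` because `l m = 1` and `l ≠ m`.
    have horth : star (W *ᵥ ψ - m • ψ) ⬝ᵥ (W *ᵥ ψ - l • ψ) = 0 := by
      have h := star_mulVec_dotProduct_mulVec hW (W *ᵥ ψ - m • ψ) (W *ᵥ ψ - l • ψ)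
      rw [hv, hw, star_smul, smul_dotProduct, dotProduct_smul, smul_smul, smul_eq_mul] at h
      have hsl : star l = m := by
        apply Complex.ext <;> simp [hl, hm]
      rw [hsl] at h
      have h2 : (m * m - 1) * (star (W *ᵥ ψ - m • ψ) ⬝ᵥ (W *ᵥ ψ - l • ψ)) = 0 := by
        rw [sub_mul, one_mul, h, sub_self]
      refine (mul_eq_zero.1 h2).resolve_left fun h3 => hd ?_
      have : m * (l - m) = 0 := by rw [mul_sub, mul_comm m l, hlm1]; linear_combination -h3
      refine (mul_eq_zero.1 this).resolve_left fun hm0 => ?_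
      rw [hm0, norm_zero] at nm
      exact zero_ne_one nm
    -- The spectral projections of `ψ`, as `hWW` says that `(W - l)(W - m)` kills `ψ`.
    refine ⟨(l - m)⁻¹ • (W *ᵥ ψ - m • ψ), (-(l - m)⁻¹) • (W *ᵥ ψ - l • ψ), l, m, ?_, ?_, ?_, ?_,
      nl, nm, dl, dm⟩
    · rw [neg_smul, ← sub_eq_add_neg, ← smul_sub, sub_sub_sub_cancel_left, ← sub_smul, smul_smul,
        inv_mul_cancel₀ hd, one_smul]
    · rw [star_smul, smul_dotProduct, dotProduct_smul, horth]; simp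
    · rw [Matrix.mulVec_smul, hv, smul_comm]
    · rw [Matrix.mulVec_smul, hw, smul_comm]

theorem pow_mulVec_of_eigenvector {W : Matrix ι ι ℂ} {v : ι → ℂ} {l : ℂ} (h : W *ᵥ v = l • v)
    (k : ℕ) : (W ^ k) *ᵥ v = l ^ k • v := by
  induction k with
  | zero => simp
  | succ k ih => rw [pow_succ, ← Matrix.mulVec_mulVec, h, Matrix.mulVec_smul, ih, smul_smul,
      pow_succ, mul_comm]

/-- The reflection that fixes the unit vector `ψ` and negates its orthogonal complement. -/
def reflection (ψ : ι → ℂ) (hψ : star ψ ⬝ᵥ ψ = 1) : Matrix.unitaryGroup ι ℂ :=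
  ⟨(2 : ℂ) • Matrix.vecMulVec ψ (star ψ) - 1, by
    have hs : star (Matrix.vecMulVec ψ (star ψ)) = Matrix.vecMulVec ψ (star ψ) := by
      rw [Matrix.star_eq_conjTranspose, Matrix.conjTranspose_vecMulVec, star_star]
    have hP : Matrix.vecMulVec ψ (star ψ) * Matrix.vecMulVec ψ (star ψ) =
        Matrix.vecMulVec ψ (star ψ) := by
      rw [Matrix.vecMulVec_mul_vecMulVec, hψ, one_smul]
    have h2 : star (2 : ℂ) = 2 := by simp
    rw [Matrix.mem_unitaryGroup_iff, star_sub, star_smul, hs, star_one, h2, sub_mul, mul_sub,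
      smul_mul_smul_comm, hP, mul_one, one_mul]
    match_scalars <;> norm_num⟩

theorem reflection_mulVec (ψ : ι → ℂ) (hψ : star ψ ⬝ᵥ ψ = 1) (v : ι → ℂ) :
    (reflection ψ hψ : Matrix ι ι ℂ) *ᵥ v = (2 * (star ψ ⬝ᵥ v)) • ψ - v := by
  simp only [reflection, Matrix.sub_mulVec, Matrix.smul_mulVec, Matrix.one_mulVec,
    Matrix.vecMulVec_mulVec]
  simp [mul_smul]

/-- The unitary that negates the basis vectors selected by `f`. -/
def phaseFlip (f : ι → Bool) : Matrix.unitaryGroup ι ℂ :=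
  ⟨Matrix.diagonal fun i => if f i then -1 else 1, by
    rw [Matrix.mem_unitaryGroup_iff, Matrix.star_eq_conjTranspose, Matrix.diagonal_conjTranspose,
      Matrix.diagonal_mul_diagonal, ← Matrix.diagonal_one]
    congr 1
    funext i
    cases h : f i <;> simp [h]⟩

/-- The iterate of amplitude amplification, for the initial vector `ψ`. -/
def amplify (ψ : ι → ℂ) (hψ : star ψ ⬝ᵥ ψ = 1) (f : ι → Bool) (A : Matrix.unitaryGroup ι ℂ) :
    Matrix.unitaryGroup ι ℂ :=
  reflection ψ hψ * (star A * (phaseFlip f * A))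

/-- `W` is a product of two involutions, `B = A† S A` and the reflection about `ψ`, with `⟨ψ, Bψ⟩ =
1 - 2p`. This is the cosine of the rotation angle, so `|1 - l|² = 2 - 2(1 - 2p) = 4p`. -/
theorem exists_eigenvectors_amplify (ψ : ι → ℂ) (hψ : star ψ ⬝ᵥ ψ = 1) (f : ι → Bool)
    (A : Matrix.unitaryGroup ι ℂ) {p : ℝ}
    (hp : p = ∑ i with f i = true, ‖((A : Matrix ι ι ℂ) *ᵥ ψ) i‖ ^ 2) :
    ∃ (v w : ι → ℂ) (l m : ℂ), ψ = v + w ∧ star v ⬝ᵥ w = 0 ∧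
      (∀ k : ℕ, ((amplify ψ hψ f A ^ k : Matrix.unitaryGroup ι ℂ) : Matrix ι ι ℂ) *ᵥ ψ =
        l ^ k • v + m ^ k • w) ∧
      ‖l‖ = 1 ∧ ‖m‖ = 1 ∧ ‖1 - l‖ = 2 * √p ∧ ‖1 - m‖ = 2 * √p := by
  have htot : ∑ i, ‖((A : Matrix ι ι ℂ) *ᵥ ψ) i‖ ^ 2 = 1 := by
    apply Complex.ofReal_injective
    rw [sum_norm_sq_eq_dotProduct, star_mulVec_dotProduct_mulVec A.2, hψ, Complex.ofReal_one]
  have hp0 : 0 ≤ p := by rw [hp]; positivity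
  have hp1 : p ≤ 1 := by
    rw [hp, ← htot]
    exact Finset.sum_le_sum_of_subset_of_nonneg (Finset.subset_univ _) fun _ _ _ => by positivity
  set B : Matrix ι ι ℂ := ((star A * (phaseFlip f * A) : Matrix.unitaryGroup ι ℂ) : Matrix ι ι ℂ)
    with hB
  set W : Matrix ι ι ℂ := (amplify ψ hψ f A : Matrix ι ι ℂ) with hW
  have hWB : ∀ v, W *ᵥ v = (2 * (star ψ ⬝ᵥ (B *ᵥ v))) • ψ - B *ᵥ v := fun v => by
    rw [hW, amplify, Submonoid.coe_mul, ← Matrix.mulVec_mulVec, reflection_mulVec]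
  have hBB : ∀ v, B *ᵥ (B *ᵥ v) = v := fun v => by
    have hff : phaseFlip f * phaseFlip f = 1 := by
      apply Subtype.ext
      simp only [phaseFlip, Submonoid.coe_mul, Matrix.diagonal_mul_diagonal, Submonoid.coe_one]
      rw [← Matrix.diagonal_one]
      congr 1
      funext i
      cases h : f i <;> simp
    have : (star A * (phaseFlip f * A)) * (star A * (phaseFlip f * A)) = 1 := by
      calc _ = star A * (phaseFlip f * (A * star A) * phaseFlip f * A) := by
            simp only [mul_assoc]
        _ = 1 := by
          rw [Unitary.mul_star_self, mul_one, hff, one_mul, Unitary.star_mul_self]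
    rw [Matrix.mulVec_mulVec, hB, ← Submonoid.coe_mul, this, Submonoid.coe_one, Matrix.one_mulVec]
  have hψB : star ψ ⬝ᵥ (B *ᵥ ψ) = ((1 - 2 * p : ℝ) : ℂ) := by
    have e1 : star ψ ⬝ᵥ (B *ᵥ ψ) = star ((A : Matrix ι ι ℂ) *ᵥ ψ) ⬝ᵥ
        ((phaseFlip f : Matrix ι ι ℂ) *ᵥ ((A : Matrix ι ι ℂ) *ᵥ ψ)) := by
      rw [hB, Submonoid.coe_mul, Submonoid.coe_mul, ← Matrix.mulVec_mulVec, ← Matrix.mulVec_mulVec,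
        ← star_mulVec_dotProduct_mulVec A.2 ψ, Matrix.mulVec_mulVec]
      rw [← Submonoid.coe_mul, Unitary.mul_star_self, Submonoid.coe_one, Matrix.one_mulVec]
    rw [e1]
    simp only [phaseFlip, dotProduct, Matrix.mulVec_diagonal, Pi.star_apply]
    rw [hp, ← htot, Finset.sum_filter, Finset.mul_sum, ← Finset.sum_sub_distrib]
    push_cast
    refine Finset.sum_congr rfl fun i _ => ?_
    have := Complex.conj_mul' (((A : Matrix ι ι ℂ) *ᵥ ψ) i)
    cases f i
    · simp [this]
    · simp [this]; ring
  have hψW : star ψ ⬝ᵥ (W *ᵥ ψ) = ((1 - 2 * p : ℝ) : ℂ) := by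
    rw [hWB, dotProduct_sub, dotProduct_smul, hψ, hψB, smul_eq_mul]; ring
  have hWW : W *ᵥ (W *ᵥ ψ) = (2 * ((1 - 2 * p : ℝ) : ℂ)) • (W *ᵥ ψ) - ψ := by
    -- `B` is an involution and the reflection fixes `ψ`; hence the quadratic relation for `W`.
    have h1 : W *ᵥ (B *ᵥ ψ) = ψ := by
      rw [hWB, hBB, hψ, mul_one, two_smul, add_sub_cancel_right]
    conv_lhs => rw [hWB ψ, Matrix.mulVec_sub, Matrix.mulVec_smul, h1, hψB]
  have habs : |1 - 2 * p| ≤ 1 := by rw [abs_le]; constructor <;> linarith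
  obtain ⟨v, w, l, m, hvw, ho, hv, hw, nl, nm, dl, dm⟩ :=
    exists_eigenvectors (amplify ψ hψ f A).2 habs hψ hψW hWW
  have hsq : ∀ x : ℂ, ‖1 - x‖ ^ 2 = 2 - 2 * (1 - 2 * p) → ‖1 - x‖ = 2 * √p := fun x hx => by
    rw [← sq_eq_sq₀ (norm_nonneg _) (by positivity), hx, mul_pow, Real.sq_sqrt hp0]; ring
  refine ⟨v, w, l, m, hvw, ho, fun k => ?_, nl, nm, hsq l dl, hsq m dm⟩
  rw [SubmonoidClass.coe_pow, ← pow_mulVec_of_eigenvector hv, ← pow_mulVec_of_eigenvector hw,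
    ← Matrix.mulVec_add]
  exact congrArg _ hvw

end Eigen

/-! ### Completing orthonormal families -/

section Extension
variable {ι κ : Type*} [DecidableEq ι] [Fintype κ]

theorem orthonormal_toLp_iff {v : ι → κ → ℂ} :
    Orthonormal ℂ (fun i => WithLp.toLp 2 (v i)) ↔
      ∀ i j, star (v i) ⬝ᵥ v j = if i = j then 1 else 0 := by
  rw [orthonormal_iff_ite]
  refine forall₂_congr fun i j => ?_
  rw [EuclideanSpace.inner_toLp_toLp, dotProduct_comm]

variable [Fintype ι] [DecidableEq κ]

/-- An orthonormal family of vectors can be completed. -/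
theorem exists_unitary_columns (f : ι ↪ κ) {v : ι → κ → ℂ}
    (hv : ∀ i j, star (v i) ⬝ᵥ v j = if i = j then 1 else 0) :
    ∃ U : Matrix.unitaryGroup κ ℂ,
      ∀ i, (U : Matrix κ κ ℂ) *ᵥ (Pi.single (f i) 1) = v i := by
  classical
  let v' : κ → EuclideanSpace ℂ κ := fun k =>
    if h : ∃ i, f i = k then WithLp.toLp 2 (v h.choose) else 0
  have hv' : ∀ i, v' (f i) = WithLp.toLp 2 (v i) := fun i => by
    have h : ∃ i', f i' = f i := ⟨i, rfl⟩
    simp only [v', dif_pos h]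
    rw [f.injective h.choose_spec]
  have ho : Orthonormal ℂ ((Set.range f).domRestrict v') := by
    have h1 := orthonormal_toLp_iff.2 hv
    rw [orthonormal_iff_ite] at h1 ⊢
    rintro ⟨_, i, rfl⟩ ⟨_, j, rfl⟩
    simp only [Set.domRestrict_apply, hv', h1]
    by_cases h : i = j
    · subst h; simp
    · rw [if_neg h, if_neg fun h' => h (f.injective (congrArg Subtype.val h'))]
  obtain ⟨b, hb⟩ := ho.exists_orthonormalBasis_extension_of_card_eq (by simp)
  have hbo := b.orthonormal
  rw [orthonormal_iff_ite] at hbo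
  refine ⟨⟨Matrix.of fun k l => b l k, ?_⟩, fun i => ?_⟩
  · rw [Matrix.mem_unitaryGroup_iff']
    ext k l
    have := hbo k l
    rw [EuclideanSpace.inner_eq_star_dotProduct, dotProduct_comm] at this
    rw [Matrix.one_apply, ← this]
    simp [Matrix.mul_apply, dotProduct]
  · have : v i = (b (f i)).ofLp := by rw [hb _ ⟨i, rfl⟩, hv']
    rw [Matrix.mulVec_single_one, this]
    rfl

/-- A linear isometry between subspaces, given on orthonormal families, extends to a unitary. -/
theorem exists_unitary_mulVec_eq (f : ι ↪ κ) {u v : ι → κ → ℂ}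
    (hu : ∀ i j, star (u i) ⬝ᵥ u j = if i = j then 1 else 0)
    (hv : ∀ i j, star (v i) ⬝ᵥ v j = if i = j then 1 else 0) :
    ∃ U : Matrix.unitaryGroup κ ℂ, ∀ i, (U : Matrix κ κ ℂ) *ᵥ u i = v i := by
  obtain ⟨U, hU⟩ := exists_unitary_columns f hu
  obtain ⟨V, hV⟩ := exists_unitary_columns f hv
  refine ⟨V * star U, fun i => ?_⟩
  rw [← hU, Matrix.mulVec_mulVec, ← Submonoid.coe_mul, mul_assoc, Unitary.star_mul_self, mul_one,
    hV]

end Extension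

/-- The initial states are members of an orthonormal basis. -/
theorem Interface.exists_basis {X : Type*} {Q : Type} [Fintype Q] [DecidableEq Q]
    (I : Interface X Q) : ∃ e : (Q → Bool) → State Q,
      (∀ z w, star (e z) ⬝ᵥ e w = if z = w then 1 else 0) ∧ ∀ x, ∃ z, e z = I.input x := by
  classical
  -- The family is indexed by the set of states, so that inputs sharing a state are counted once.
  have ho : Orthonormal ℂ
      ((↑) : Set.range (fun x => WithLp.toLp 2 (I.input x)) → EuclideanSpace ℂ (Q → Bool)) := by
    rw [orthonormal_iff_ite]
    rintro ⟨_, x, rfl⟩ ⟨_, y, rfl⟩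
    rw [EuclideanSpace.inner_toLp_toLp, dotProduct_comm]
    rcases I.input_orth x y with h | h
    · simp [h, I.input_unit]
    · rw [h, if_neg]
      intro hxy
      have : I.input x = I.input y := WithLp.toLp_injective 2 (congrArg Subtype.val hxy)
      rw [this, I.input_unit] at h
      exact one_ne_zero h
  obtain ⟨u, b, hsub, hb⟩ := ho.exists_orthonormalBasis_extension
  have hcard : Fintype.card u = Fintype.card (Q → Bool) := by
    rw [← Module.finrank_eq_card_basis b.toBasis, finrank_euclideanSpace]
  let c := b.reindex (Fintype.equivOfCardEq hcard)
  refine ⟨fun z => (c z).ofLp, orthonormal_toLp_iff.1 c.orthonormal, fun x => ?_⟩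
  refine ⟨Fintype.equivOfCardEq hcard ⟨_, hsub ⟨x, rfl⟩⟩, ?_⟩
  simp [c, hb]

/-! ### Relabelled and block-diagonal unitaries -/

section Transport
variable {ι κ : Type*} [Fintype ι] [DecidableEq ι] [Fintype κ] [DecidableEq κ]

/-- A unitary matrix with relabelled indices. -/
def relabel (E : ι ≃ κ) : Matrix.unitaryGroup κ ℂ →* Matrix.unitaryGroup ι ℂ where
  toFun U := ⟨(U : Matrix κ κ ℂ).submatrix E E, by
    rw [Matrix.mem_unitaryGroup_iff, Matrix.star_eq_conjTranspose, Matrix.conjTranspose_submatrix,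
      Matrix.submatrix_mul_equiv, ← Matrix.star_eq_conjTranspose,
      Matrix.mem_unitaryGroup_iff.1 U.2, Matrix.submatrix_one_equiv]⟩
  map_one' := Subtype.ext (Matrix.submatrix_one_equiv E)
  map_mul' U V := Subtype.ext (Matrix.submatrix_mul_equiv _ _ _ _ _).symm

theorem relabel_mulVec (E : ι ≃ κ) (U : Matrix.unitaryGroup κ ℂ) (v : κ → ℂ) :
    (relabel E U : Matrix ι ι ℂ) *ᵥ (v ∘ E) = ((U : Matrix κ κ ℂ) *ᵥ v) ∘ E := by
  have := Matrix.submatrix_mulVec_equiv (U : Matrix κ κ ℂ) (v ∘ E) E E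
  rw [Function.comp_assoc, Equiv.self_comp_symm, Function.comp_id] at this
  exact this

/-- The unitary that applies `U t` in the sector `t`. -/
def controlled : (κ → Matrix.unitaryGroup ι ℂ) →* Matrix.unitaryGroup (ι × κ) ℂ where
  toFun U := ⟨Matrix.blockDiagonal fun t => (U t : Matrix ι ι ℂ), by
    rw [Matrix.mem_unitaryGroup_iff, Matrix.star_eq_conjTranspose,
      Matrix.blockDiagonal_conjTranspose, ← Matrix.blockDiagonal_mul, ← Matrix.blockDiagonal_one]
    congr 1
    funext t
    exact Matrix.mem_unitaryGroup_iff.1 (U t).2⟩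
  map_one' := Subtype.ext Matrix.blockDiagonal_one
  map_mul' U V := Subtype.ext (Matrix.blockDiagonal_mul
    (fun t => (U t : Matrix ι ι ℂ)) fun t => (V t : Matrix ι ι ℂ))

theorem controlled_mulVec (U : κ → Matrix.unitaryGroup ι ℂ) (v : ι × κ → ℂ) (z : ι) (t : κ) :
    ((controlled U : Matrix (ι × κ) (ι × κ) ℂ) *ᵥ v) (z, t) =
      ((U t : Matrix ι ι ℂ) *ᵥ fun z' => v (z', t)) z := by
  simp [controlled, Matrix.mulVec, dotProduct, Fintype.sum_prod_type,
    Matrix.blockDiagonal_apply, ite_mul]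

end Transport

/-! ### Controlled powers with uncontrolled calls -/

section Program
variable {Q R T : Type} [Fintype Q] [DecidableEq Q] [Fintype R] [DecidableEq R]
  [Fintype T] [DecidableEq T]

/-- The basis states of a joint register, when those of the ancillary register are labelled
by `T`. -/
def jointEquiv (Q : Type) (e : (R → Bool) ≃ T) : (Q ⊕ R → Bool) ≃ (Q → Bool) × T :=
  (Equiv.sumArrowEquivProdArrow Q R Bool).trans (Equiv.prodCongr (Equiv.refl _) e)

theorem extend_eq_relabel (e : (R → Bool) ≃ T) (A : Gate Q) :
    extend R A = relabel (jointEquiv Q e) (controlled fun _ => A) := by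
  apply Subtype.ext
  simp only [extend, relabel, controlled, MonoidHom.coe_mk, OneHom.coe_mk, Matrix.kronecker_one]
  ext p q
  simp only [jointEquiv, Matrix.coe_reindexAlgEquiv, Matrix.reindex_apply, Equiv.symm_symm,
    Matrix.submatrix_apply, Matrix.blockDiagonal_apply, Equiv.trans_apply, Equiv.prodCongr_apply,
    Prod.map_snd, Prod.map_fst, e.injective.eq_iff, Equiv.refl_apply]

theorem Program.run_append (A : Gate Q) (p q : Program Q R) :
    Program.run A (p ++ q) = Program.run A q * Program.run A p := by
  induction p with
  | nil => simp [Program.run]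
  | cons s p ih => simp only [List.cons_append, Program.run, ih, mul_assoc]

theorem Program.calls_append (p q : Program Q R) :
    Program.calls (p ++ q) = p.calls + q.calls := by
  simp [Program.calls]

/-- `N` rounds of a call, a controlled gate, an adjoint call and another controlled gate; the
gates are `D` and `V t` in the sector `t`, in the first `k t` rounds only. -/
def rounds (e : (R → Bool) ≃ T) (D : Gate Q) (V : T → Gate Q) (k : T → ℕ) :
    ℕ → Program Q R
  | 0 => []
  | N + 1 => rounds e D V k N ++
      [.call, .gate (relabel (jointEquiv Q e) (controlled fun t => if N < k t then D else 1)),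
        .callAdjoint,
        .gate (relabel (jointEquiv Q e) (controlled fun t => if N < k t then V t else 1))]

theorem calls_rounds (e : (R → Bool) ≃ T) (D : Gate Q) (V : T → Gate Q) (k : T → ℕ) (N : ℕ) :
    (rounds e D V k N).calls = 2 * N := by
  induction N with
  | zero => rfl
  | succ N ih =>
    rw [rounds, Program.calls_append, ih]
    simp [Program.calls, Step.cost]
    ring

/-- In a sector whose count `k t` is exhausted, both gates are the identity and the two calls cancel
as `A† A = 1`. So the calls themselves need no control. -/
theorem run_rounds (e : (R → Bool) ≃ T) (D : Gate Q) (V : T → Gate Q) (k : T → ℕ) (A : Gate Q)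
    (N : ℕ) : (rounds e D V k N).run A = relabel (jointEquiv Q e)
      (controlled fun t => (V t * (star A * (D * A))) ^ min N (k t)) := by
  induction N with
  | zero =>
    simp only [rounds, Program.run, Nat.zero_min, pow_zero]
    exact ((map_one (relabel (jointEquiv Q e))).symm.trans
      (congrArg _ (map_one controlled).symm))
  | succ N ih =>
    rw [rounds, Program.run_append, ih]
    simp only [Program.run, Step.eval, extend_eq_relabel e, one_mul, ← map_mul]
    congr 2
    funext t
    simp only [Pi.mul_apply]
    by_cases h : N < k t
    · rw [if_pos h, if_pos h, min_eq_left h.le, min_eq_left (Nat.succ_le_of_lt h), pow_succ']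
      simp only [mul_assoc]
    · rw [if_neg h, if_neg h, min_eq_right (not_lt.1 h),
        min_eq_right ((not_lt.1 h).trans (Nat.le_succ N))]
      simp

end Program

/-! ### Writing the decision to the output qubit -/

section Measurement
variable {Q : Type} [Fintype Q] [DecidableEq Q] {K : Type} [Fintype K] [DecidableEq K]

/-- The permutation of basis states that replaces the bit `q` by `b + f k`, and `b` by the old
value of `q`. -/
def storeEquiv (q : Q) (f : K → Bool) :
    (Q → Bool) × ((Q → Bool) × K × Bool) ≃ (Q → Bool) × ((Q → Bool) × K × Bool) where
  toFun p := (Function.update p.1 q (xor p.2.2.2 (f p.2.2.1)), (p.2.1, p.2.2.1, p.1 q))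
  invFun p := (Function.update p.1 q p.2.2.2, (p.2.1, p.2.2.1, xor (p.1 q) (f p.2.2.1)))
  left_inv p := by ext <;> simp
  right_inv p := by ext <;> simp

/-- The unitary that applies `F` to the register `K` and copies the bit `f` of the outcome to
the qubit `q`. -/
def measureGate (q : Q) (f : K → Bool) (F : Matrix.unitaryGroup K ℂ) :
    Matrix.unitaryGroup ((Q → Bool) × ((Q → Bool) × K × Bool)) ℂ :=
  ⟨((1 : Matrix (Q → Bool) (Q → Bool) ℂ) ⊗ₖ ((1 : Matrix (Q → Bool) (Q → Bool) ℂ) ⊗ₖ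
      ((F : Matrix K K ℂ) ⊗ₖ (1 : Matrix Bool Bool ℂ)))).submatrix (storeEquiv q f).symm id, by
    have h := Matrix.kronecker_mem_unitary (one_mem (Matrix.unitaryGroup (Q → Bool) ℂ))
      (Matrix.kronecker_mem_unitary (one_mem (Matrix.unitaryGroup (Q → Bool) ℂ))
        (Matrix.kronecker_mem_unitary F.2 (one_mem (Matrix.unitaryGroup Bool ℂ))))
    rw [Matrix.mem_unitaryGroup_iff] at h ⊢
    rw [Matrix.star_eq_conjTranspose, Matrix.conjTranspose_submatrix,
      ← Matrix.submatrix_mul _ _ _ _ _ Function.bijective_id, ← Matrix.star_eq_conjTranspose, h,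
      Matrix.submatrix_one_equiv]⟩

theorem measureGate_mulVec (q : Q) (f : K → Bool) (F : Matrix.unitaryGroup K ℂ)
    (v : (Q → Bool) × ((Q → Bool) × K × Bool) → ℂ) (z w : Q → Bool) (k : K) (b : Bool) :
    ((measureGate q f F : Matrix _ _ ℂ) *ᵥ v) (storeEquiv q f (z, (w, k, b))) =
      ∑ k', (F : Matrix K K ℂ) k k' * v (z, (w, k', b)) := by
  simp only [measureGate, Matrix.mulVec, dotProduct, Matrix.submatrix_apply,
    Equiv.symm_apply_apply, id, Fintype.sum_prod_type, Matrix.kroneckerMap_apply,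
    Matrix.one_apply, ite_mul, mul_ite, one_mul, mul_one, zero_mul, mul_zero,
    Finset.sum_ite_eq, Finset.sum_const_zero, Finset.mem_univ, if_true, Finset.sum_ite_irrel]

end Measurement

/-! ### The phase estimation program -/

section Simulation

/-- The product of two vectors. -/
def prodVec {ι κ : Type*} (ψ : ι → ℂ) (φ : κ → ℂ) : ι × κ → ℂ := fun p => ψ p.1 * φ p.2

theorem prodVec_dotProduct {ι κ : Type*} [Fintype ι] [Fintype κ] (ψ ψ' : ι → ℂ) (φ φ' : κ → ℂ) :
    star (prodVec ψ φ) ⬝ᵥ prodVec ψ' φ' = (star ψ ⬝ᵥ ψ') * (star φ ⬝ᵥ φ') := by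
  simp only [dotProduct, Finset.sum_mul_sum, prodVec, Pi.star_apply, star_mul',
    Fintype.sum_prod_type]
  refine Finset.sum_congr rfl fun i _ => Finset.sum_congr rfl fun j _ => ?_
  ring

theorem star_single_dotProduct_single {ι : Type*} [Fintype ι] [DecidableEq ι] (i j : ι) :
    star (Pi.single i (1 : ℂ)) ⬝ᵥ (Pi.single j 1 : ι → ℂ) = if i = j then 1 else 0 := by
  rw [dotProduct_single_one, Pi.star_apply, Pi.single_apply]
  by_cases h : i = j
  · simp [h]
  · simp [h, Ne.symm h]

/-- Amplitude amplification, iterated `κ k` times in superposition over `k` with amplitudes `α k`,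
then `F` on the register `K`, then the bit `f` of the outcome as the output. -/
theorem exists_program_outcomeProb {X : Type*} {n : ℕ} (I : Interface X (Fin n))
    {K : Type} [Fintype K] [DecidableEq K] {b : ℕ} (hK : Fintype.card K = 2 ^ b)
    {α : K → ℂ} (hα : ∑ k, ‖α k‖ ^ 2 = 1) (F : Matrix.unitaryGroup K ℂ) (f : K → Bool)
    {κ : K → ℕ} {N : ℕ} (hκ : ∀ k, κ k ≤ N) :
    ∃ (a : ℕ) (p : Program (Fin n) (Fin a)), p.calls = 2 * N ∧
      ∀ (A : Gate (Fin n)) (x : X) (c : Bool),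
        (I.withAncilla (Fin a)).outcomeProb (p.run A) x c =
          ∑ k with f k = c, ∑ z, ‖∑ k', (F : Matrix K K ℂ) k k' * α k' *
            (((amplify (I.input x) (I.input_unit x) (fun z => z I.out) A ^ κ k' : Gate (Fin n)) :
              Matrix (Fin n → Bool) (Fin n → Bool) ℂ) *ᵥ I.input x) z‖ ^ 2 := by
  obtain ⟨e, he, heI⟩ := I.exists_basis
  have he1 : ∀ w, star (e w) ⬝ᵥ e w = 1 := fun w => by rw [he, if_pos rfl]
  -- The ancillas hold the label of the initial state (`n` qubits), the counter (`b` qubits) and one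
  -- bit that is exchanged with the output qubit.
  let T := (Fin n → Bool) × K × Bool
  have hcard : Fintype.card (Fin (n + b + 1) → Bool) = Fintype.card T := by
    simp [T, hK, pow_add, mul_assoc]
  let ε : (Fin (n + b + 1) → Bool) ≃ T := Fintype.equivOfCardEq hcard
  let t₀ : T := ε fun _ => false
  let J := jointEquiv (Fin n) ε
  -- The first gate sends `u w` to `v w`: it writes the label `w` and prepares the window in the
  -- counter. This is isometric since the `e w` are orthonormal.
  let u : (Fin n → Bool) → (Fin n → Bool) × T → ℂ := fun w => prodVec (e w) (Pi.single t₀ 1)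
  let v : (Fin n → Bool) → (Fin n → Bool) × T → ℂ := fun w =>
    prodVec (e w) (prodVec (Pi.single w 1) (prodVec α (Pi.single false 1)))
  have hα' : star α ⬝ᵥ α = 1 := by rw [← sum_norm_sq_eq_dotProduct, hα, Complex.ofReal_one]
  have hv : ∀ i j : Fin n → Bool,
      star (prodVec (Pi.single i 1) (prodVec α (Pi.single false 1))) ⬝ᵥ
        prodVec (Pi.single j 1) (prodVec α (Pi.single false 1)) = if i = j then 1 else 0 := by
    intro i j
    simp only [prodVec_dotProduct, star_single_dotProduct_single, hα', if_true, mul_one]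
  obtain ⟨G, hG⟩ := exists_unitary_mulVec_eq (u := u) (v := v)
    ⟨fun w => (w, t₀), fun w w' h => congrArg Prod.fst h⟩
    (fun i j => by
      simp only [u, prodVec_dotProduct, he, star_single_dotProduct_single, if_true, mul_one])
    (fun i j => by
      refine (prodVec_dotProduct _ _ _ _).trans ?_
      rw [he, hv]
      split_ifs <;> simp)
  let D : Gate (Fin n) := phaseFlip fun z => z I.out
  let V : T → Gate (Fin n) := fun t => reflection (e t.1) (he1 t.1)
  refine ⟨n + b + 1, [.gate (relabel J G)] ++ (rounds ε D V (fun t => κ t.2.1) N ++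
    [.gate (relabel J (measureGate I.out f F))]), ?_, fun A x c => ?_⟩
  · rw [Program.calls_append, Program.calls_append, calls_rounds]
    simp [Program.calls, Step.cost]
  · obtain ⟨w, hw⟩ := heI x
    have hamp : ∀ (ψ : State (Fin n)) (hψ : star ψ ⬝ᵥ ψ = 1), e w = ψ →
        amplify (e w) (he1 w) (fun z => z I.out) A = amplify ψ hψ (fun z => z I.out) A := by
      rintro _ _ rfl; rfl
    rw [← hamp _ (I.input_unit x) hw, ← hw]
    have hin : (I.withAncilla (Fin (n + b + 1))).input x = u w ∘ J := by
      funext p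
      simp only [Interface.withAncilla, tensor, zeroState, ← hw, u, prodVec, Function.comp_apply, J,
        jointEquiv, Equiv.trans_apply, Equiv.prodCongr_apply, Equiv.sumArrowEquivProdArrow,
        Equiv.coe_fn_mk, Prod.map, Equiv.refl_apply, Pi.single_apply, t₀, ε.injective.eq_iff]
      rfl
    rw [Program.run_append, Program.run_append, run_rounds]
    simp only [Program.run, Step.eval, one_mul]
    rw [← map_mul, ← map_mul, Interface.outcomeProb, hin, relabel_mulVec]
    simp only [Submonoid.coe_mul, ← Matrix.mulVec_mulVec, hG]
    set Φ : (Fin n → Bool) × T → ℂ := ((controlled fun t : T =>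
      (V t * (star A * (D * A))) ^ min N (κ t.2.1) :
        Matrix.unitaryGroup ((Fin n → Bool) × T) ℂ) : Matrix _ _ ℂ) *ᵥ v w with hΦ
    have hΦz : ∀ z w' k b, Φ (z, (w', k, b)) = if w' = w ∧ b = false then
        α k * (((amplify (e w) (he1 w) (fun z => z I.out) A ^ κ k : Gate (Fin n)) :
              Matrix (Fin n → Bool) (Fin n → Bool) ℂ) *ᵥ e w) z else 0 := by
      intro z w' k b
      rw [hΦ, controlled_mulVec]
      have : (fun z' => v w (z', (w', k, b))) =
          ((Pi.single w 1 : _ → ℂ) w' * (α k * (Pi.single false 1 : Bool → ℂ) b)) • e w := by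
        funext z'
        simp only [v, prodVec, Pi.smul_apply, smul_eq_mul]
        ring
      rw [this, Matrix.mulVec_smul]
      split_ifs with h
      · obtain ⟨rfl, rfl⟩ := h
        simp only [min_eq_right (hκ k), Pi.single_eq_same, one_mul, mul_one, Pi.smul_apply,
          smul_eq_mul]
        rfl
      · rw [not_and_or] at h
        rcases h with h | h <;> simp [Pi.single_apply, h]
    rw [Finset.sum_filter, Finset.sum_filter]
    -- Final basis states are counted through their preimages under `storeEquiv`. Among these only
    -- label `w` and bit `false` carry amplitude, and for bit `false` the new output is `f k`.
    have hsum := fun g : (Fin n → Bool) × T → ℝ =>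
      (J.sum_comp g).trans ((storeEquiv I.out f).sum_comp g).symm
    refine (hsum fun q => if q.1 I.out = c then
      ‖((measureGate I.out f F : Matrix _ _ ℂ) *ᵥ Φ) q‖ ^ 2 else 0).trans ?_
    simp only [T, Fintype.sum_prod_type]
    simp only [measureGate_mulVec, hΦz]
    simp only [storeEquiv, Equiv.coe_fn_mk, Function.update_self, Fintype.sum_bool]
    simp only [Bool.true_eq_false, and_false, if_false, mul_zero, Finset.sum_const_zero, norm_zero,
      ne_eq, OfNat.ofNat_ne_zero, not_false_eq_true, zero_pow, ite_self, zero_add, and_true,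
      Bool.false_xor]
    have hw' : ∀ z, ∑ w', ∑ k, (if f k = c then ‖∑ k', (F : Matrix K K ℂ) k k' *
          (if w' = w then α k' * (((amplify (e w) (he1 w) (fun z => z I.out) A ^ κ k' : Gate (Fin n)) :
              Matrix (Fin n → Bool) (Fin n → Bool) ℂ) *ᵥ e w) z else 0)‖ ^ 2 else 0) =
        ∑ k, (if f k = c then ‖∑ k', (F : Matrix K K ℂ) k k' *
          (α k' * (((amplify (e w) (he1 w) (fun z => z I.out) A ^ κ k' : Gate (Fin n)) :
              Matrix (Fin n → Bool) (Fin n → Bool) ℂ) *ᵥ e w) z)‖ ^ 2 else 0) := fun z => by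
      rw [Finset.sum_eq_single w]
      · simp
      · intro w' _ h; simp [h]
      · simp
    simp only [hw', mul_assoc]
    rw [Finset.sum_comm]
    refine Finset.sum_congr rfl fun k _ => ?_
    split_ifs <;> simp

end Simulation

/-! ### Error analysis -/

section Estimation
variable {X : Type*} {n : ℕ}

/-- Outcome `j` leaves the vector `estimate α l j • v + estimate α m j • w`. As `v` and `w` are
orthogonal there is no interference, and the probability is an average with weights `‖v‖²` and
`‖w‖²`, which sum to `1`. -/
theorem sum_norm_sq_estimate_le {ι : Type*} [Fintype ι] [DecidableEq ι] {N : ℕ} {α : Fin N → ℂ}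
    {ψ v w : ι → ℂ} (hψ : star ψ ⬝ᵥ ψ = 1) (hvw : ψ = v + w) (ho : star v ⬝ᵥ w = 0) {l m : ℂ}
    {U : Fin N → Matrix ι ι ℂ} (hU : ∀ k, U k *ᵥ ψ = l ^ (k : ℕ) • v + m ^ (k : ℕ) • w)
    {J : Finset (Fin N)} {δ : ℝ} (hl : ∑ j ∈ J, ‖estimate α l j‖ ^ 2 ≤ δ)
    (hm : ∑ j ∈ J, ‖estimate α m j‖ ^ 2 ≤ δ) :
    ∑ j ∈ J, ∑ z, ‖∑ k, fourierMatrix N j k * α k * (U k *ᵥ ψ) z‖ ^ 2 ≤ δ := by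
  have hone : ∑ z, ‖v z‖ ^ 2 + ∑ z, ‖w z‖ ^ 2 = 1 := by
    have h := sum_norm_sq_add_of_orthogonal ho 1 1
    simp only [one_mul, norm_one, one_pow] at h
    rw [← h]
    apply Complex.ofReal_injective
    rw [Complex.ofReal_one, ← hψ, ← sum_norm_sq_eq_dotProduct, hvw]
    rfl
  have hz : ∀ j, ∑ z, ‖∑ k, fourierMatrix N j k * α k * (U k *ᵥ ψ) z‖ ^ 2 =
      ‖estimate α l j‖ ^ 2 * ∑ z, ‖v z‖ ^ 2 + ‖estimate α m j‖ ^ 2 * ∑ z, ‖w z‖ ^ 2 := by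
    intro j
    rw [← sum_norm_sq_add_of_orthogonal ho]
    refine Finset.sum_congr rfl fun z _ => ?_
    congr 2
    rw [estimate, estimate, Finset.sum_mul, Finset.sum_mul, ← Finset.sum_add_distrib]
    refine Finset.sum_congr rfl fun k _ => ?_
    simp only [hU, Pi.add_apply, Pi.smul_apply, smul_eq_mul]
    ring
  have hv0 : 0 ≤ ∑ z, ‖v z‖ ^ 2 := by positivity
  have hw0 : 0 ≤ ∑ z, ‖w z‖ ^ 2 := by positivity
  calc _ = (∑ j ∈ J, ‖estimate α l j‖ ^ 2) * ∑ z, ‖v z‖ ^ 2 +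
        (∑ j ∈ J, ‖estimate α m j‖ ^ 2) * ∑ z, ‖w z‖ ^ 2 := by
        rw [Finset.sum_congr rfl fun j _ => hz j, Finset.sum_add_distrib, Finset.sum_mul,
          Finset.sum_mul]
    _ ≤ δ * ∑ z, ‖v z‖ ^ 2 + δ * ∑ z, ‖w z‖ ^ 2 := by gcongr
    _ = δ := by rw [← mul_add, hone, mul_one]

theorem Interface.outcomeProb_add (I : Interface X (Fin n)) (A : Gate (Fin n)) (x : X) :
    I.outcomeProb A x true + I.outcomeProb A x false = 1 := by
  have htot : ∑ i, ‖((A : Matrix (Fin n → Bool) (Fin n → Bool) ℂ) *ᵥ I.input x) i‖ ^ 2 = 1 := by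
    apply Complex.ofReal_injective
    rw [sum_norm_sq_eq_dotProduct, star_mulVec_dotProduct_mulVec A.2, I.input_unit,
      Complex.ofReal_one]
  rw [← htot, Interface.outcomeProb, Interface.outcomeProb, Finset.sum_filter, Finset.sum_filter,
    ← Finset.sum_add_distrib]
  refine Finset.sum_congr rfl fun z _ => ?_
  cases z I.out <;> simp

/-- Error reduction to any error above `1 / 2` needs no calls: a coin is flipped. -/
theorem exists_program_coin (I : Interface X (Fin n)) :
    ∃ (a : ℕ) (p : Program (Fin n) (Fin a)), p.calls = 0 ∧
      ∀ (A : Gate (Fin n)) (x : X) (c : Bool),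
        (I.withAncilla (Fin a)).outcomeProb (p.run A) x c = 1 / 2 := by
  have hs : ((√2 : ℝ)⁻¹) ^ 2 = 1 / 2 := by
    rw [inv_pow, Real.sq_sqrt (by norm_num)]; norm_num
  obtain ⟨a, p, hp, h⟩ := exists_program_outcomeProb I (K := Bool) (b := 1) (by simp)
    (α := fun _ => (((√2)⁻¹ : ℝ) : ℂ))
    (by simp only [Complex.norm_real, Real.norm_eq_abs, sq_abs, hs]; norm_num)
    1 id (κ := fun _ => 0) (N := 0) (fun _ => le_rfl)
  refine ⟨a, p, hp, fun A x c => ?_⟩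
  rw [h]
  have hone : ∑ z, ‖I.input x z‖ ^ 2 = 1 := by
    apply Complex.ofReal_injective
    rw [sum_norm_sq_eq_dotProduct, I.input_unit, Complex.ofReal_one]
  have hf : (Finset.univ.filter fun k : Bool => id k = c) = {c} := by ext; simp
  rw [hf, Finset.sum_singleton]
  simp only [Submonoid.coe_one, Matrix.one_apply, ite_mul, one_mul, zero_mul, Finset.sum_ite_eq,
    Finset.mem_univ, if_true, pow_zero, Matrix.one_mulVec, norm_mul, mul_pow, Complex.norm_real,
    Real.norm_eq_abs, sq_abs, hs]
  rw [← Finset.mul_sum, hone, mul_one]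

/-- Phase estimation on the iterate of amplitude amplification separates acceptance amplitudes at
most `s` from acceptance amplitudes at least `t`. -/
theorem exists_program_hasError (I : Interface X (Fin n)) {ρy ρn : ℝ}
    (hΔ : 0 < √(1 - ρy) - √ρn) (i d : ℕ) {r : ℕ} (hr : r + 1 = 2 ^ d) :
    ∃ (a : ℕ) (p : Program (Fin n) (Fin a)), p.calls = 2 * (2 ^ i * (r + 1)) ∧
      ∀ (yes no : Set X) (A : X → Gate (Fin n)), I.HasError A yes no ρy ρn →
        (I.withAncilla (Fin a)).HasError (fun x => p.run (A x)) yes no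
          ((r + 1) * (2 / ((√(1 - ρy) - √ρn) * (2 ^ i : ℕ))) ^ (2 * r))
          ((r + 1) * (2 / ((√(1 - ρy) - √ρn) * (2 ^ i : ℕ))) ^ (2 * r)) := by
  set N := 2 ^ i * (r + 1) with hN
  set Δ := √(1 - ρy) - √ρn with hΔd
  obtain ⟨α, hα, hest⟩ := exists_window (Nat.one_le_two_pow (n := i)) r
  -- The threshold is the midpoint of `2√(1 - ρy)` and `2√ρn`, each `Δ` away from it. By the reverse
  -- triangle inequality, a wrong outcome is at least `Δ` from either eigenvalue.
  let f : Fin N → Bool := fun j => decide (√(1 - ρy) + √ρn ≤ ‖1 - root N j‖)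
  obtain ⟨a, p, hp, h⟩ := exists_program_outcomeProb I (K := Fin N) (b := i + d)
    (by rw [Fintype.card_fin, hN, hr, pow_add]) hα ⟨_, fourierMatrix_mem_unitaryGroup N⟩ f
    (κ := fun k => (k : ℕ)) (N := N) (fun k => k.2.le)
  refine ⟨a, p, hp, fun yes no A hA => ?_⟩
  have key : ∀ (x : X) (c : Bool),
      (∀ (j : Fin N) (l : ℂ), f j = c → ‖1 - l‖ = 2 * √(I.outcomeProb (A x) x true) →
        Δ ≤ ‖root N j - l‖) →
      (I.withAncilla (Fin a)).outcomeProb (p.run (A x)) x c ≤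
        (r + 1) * (2 / (Δ * (2 ^ i : ℕ))) ^ (2 * r) := by
    intro x c hx
    obtain ⟨v, w, l, m, hvw, ho, hk, nl, nm, dl, dm⟩ := exists_eigenvectors_amplify (I.input x)
      (I.input_unit x) (fun z => z I.out) (A x) (p := I.outcomeProb (A x) x true) rfl
    rw [h]
    exact sum_norm_sq_estimate_le (I.input_unit x) hvw ho (fun k => hk k)
      (hest l Δ _ nl hΔ fun j hj => hx j l (Finset.mem_filter.1 hj).2 dl)
      (hest m Δ _ nm hΔ fun j hj => hx j m (Finset.mem_filter.1 hj).2 dm)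
  have tri : ∀ (j : Fin N) (l : ℂ), |‖1 - root N j‖ - ‖1 - l‖| ≤ ‖root N j - l‖ := fun j l => by
    have := abs_norm_sub_norm_le (1 - root N j) (1 - l)
    rwa [sub_sub_sub_cancel_left, norm_sub_rev l] at this
  constructor
  · intro x hx
    have hq : √(1 - ρy) ≤ √(I.outcomeProb (A x) x true) := by
      apply Real.sqrt_le_sqrt
      have := hA.1 x hx
      have := I.outcomeProb_add (A x) x
      linarith
    refine key x false fun j l hj hl => ?_
    have hj' : ‖1 - root N j‖ < √(1 - ρy) + √ρn := not_le.1 (of_decide_eq_false hj)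
    have := (abs_le.1 (tri j l)).1
    linarith
  · intro x hx
    have hq : √(I.outcomeProb (A x) x true) ≤ √ρn := Real.sqrt_le_sqrt (hA.2 x hx)
    refine key x true fun j l hj hl => ?_
    have hj' : √(1 - ρy) + √ρn ≤ ‖1 - root N j‖ := of_decide_eq_true hj
    have := (abs_le.1 (tri j l)).2
    linarith

end Estimation

theorem Interface.HasError.mono {X : Type*} {Q : Type} [Fintype Q] [DecidableEq Q]
    {I : Interface X Q} {A : X → Gate Q} {yes no : Set X} {ρy ρn ρy' ρn' : ℝ}
    (h : I.HasError A yes no ρy ρn) (hy : ρy ≤ ρy') (hn : ρn ≤ ρn') :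
    I.HasError A yes no ρy' ρn' :=
  ⟨fun x hx => (h.1 x hx).trans hy, fun x hx => (h.2 x hx).trans hn⟩

end QDecision

end

/-! ### Choice of parameters -/

theorem mainTheorem2 :
    ∃ C : ℝ, 0 < C ∧
      ∀ ρy ρn δ : ℝ, 0 ≤ ρy → 0 ≤ ρn → ρy + ρn < 1 → 0 < δ → δ < 1 →
      ∀ (X : Type*) (n : ℕ) (I : QDecision.Interface X (Fin n)),
      ∃ (a : ℕ) (p : QDecision.Program (Fin n) (Fin a)),
        (p.calls : ℝ) ≤ C * (1 / (√(1 - ρy) - √ρn) * Real.log (1 / δ)) ∧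
        ∀ (yes no : Set X) (A : X → QDecision.Gate (Fin n)),
          I.HasError A yes no ρy ρn →
          (I.withAncilla (Fin a)).HasError (fun x => p.run (A x)) yes no δ δ := by
  -- `128 = 2 · 8 · 8`: two calls per round, `m ≤ 8 / Δ` and `r + 1 ≤ 8 L`.
  refine ⟨128, by norm_num, fun ρy ρn δ hy hn hyn hδ hδ1 X n I => ?_⟩
  have hΔ : 0 < √(1 - ρy) - √ρn := sub_pos.2 (Real.sqrt_lt_sqrt hn (by linarith))
  have hΔ1 : √(1 - ρy) - √ρn ≤ 1 := by
    have h1 : √(1 - ρy) ≤ 1 := Real.sqrt_le_one.2 (by linarith)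
    linarith [Real.sqrt_nonneg ρn]
  -- As `δ` tends to `1` the bound on the calls tends to `0`, so large `δ` must be served without
  -- any call.
  by_cases hhalf : 1 / 2 ≤ δ
  · obtain ⟨a, p, hp, h⟩ := QDecision.exists_program_coin I
    refine ⟨a, p, ?_, fun yes no A _ => ⟨fun x _ => ?_, fun x _ => ?_⟩⟩
    · rw [hp, Nat.cast_zero]
      have : 0 ≤ Real.log (1 / δ) := Real.log_nonneg (by rw [le_div_iff₀ hδ]; linarith)
      positivity
    · rw [h]; exact hhalf
    · rw [h]; exact hhalf
  · rw [not_le] at hhalf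
    set Δ := √(1 - ρy) - √ρn with hΔd
    set L := Real.log (1 / δ) with hL
    have hlog2 : (1 / 2 : ℝ) < Real.log 2 := by linarith [Real.log_two_gt_d9]
    have hL2 : Real.log 2 ≤ L := Real.log_le_log (by norm_num) (by rw [le_div_iff₀ hδ]; linarith)
    -- Powers of two, so that the counter fits a qubit register. The window length `m = 2^(i+1)`
    -- exceeds `4 / Δ`, which makes `2 / (Δ m) ≤ 1/2`.
    obtain ⟨i, hi1, hi2⟩ := exists_nat_pow_near (x := 4 / Δ) (y := 2)
      (by rw [le_div_iff₀ hΔ]; linarith) one_lt_two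
    -- With `r + 1 = 2^(d+1) > 2L + 1` one gets `r ≥ 2L`, hence `2^r ≥ 1 / δ` because `log 2 > 1/2`.
    obtain ⟨d, hd1, hd2⟩ := exists_nat_pow_near (x := 2 * L + 1) (y := 2)
      (by linarith) one_lt_two
    obtain ⟨r, hr⟩ : ∃ r, r + 1 = 2 ^ (d + 1) :=
      ⟨2 ^ (d + 1) - 1, Nat.sub_add_cancel Nat.one_le_two_pow⟩
    have hr' : (r : ℝ) + 1 = 2 ^ (d + 1) := by exact_mod_cast hr
    obtain ⟨a, p, hp, h⟩ := QDecision.exists_program_hasError I hΔ (i + 1) (d + 1) hr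
    have hm4 : 4 ≤ Δ * 2 ^ (i + 1) := by
      rw [div_lt_iff₀ hΔ] at hi2; linarith
    -- The error is at most `(r + 1) 4^(-r) ≤ 2^(-r)`.
    have herr : (r + 1) * (2 / (Δ * ((2 ^ (i + 1) : ℕ) : ℝ))) ^ (2 * r) ≤ δ := by
      have h2 : 2 / (Δ * ((2 ^ (i + 1) : ℕ) : ℝ)) ≤ 1 / 2 := by
        push_cast
        rw [div_le_div_iff₀ (by linarith) two_pos]; linarith
      have h3 : (r : ℝ) + 1 ≤ 2 ^ r := by exact_mod_cast Nat.lt_two_pow_self (n := r)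
      have h4 : 1 / δ ≤ 2 ^ r := by
        rw [← Real.log_le_log_iff (by positivity) (by positivity), Real.log_pow]
        have : 2 * L ≤ r := by linarith
        nlinarith
      calc _ ≤ (2 : ℝ) ^ r * (1 / 2) ^ (2 * r) := by gcongr
        _ = 1 / 2 ^ r := by
          rw [mul_comm 2 r, pow_mul, div_pow, one_pow]; field_simp
        _ ≤ δ := by rwa [div_le_iff₀ (by positivity), ← div_le_iff₀' hδ]
    refine ⟨a, p, ?_, fun yes no A hA => (h yes no A hA).mono herr herr⟩
    -- Here `2L + 1 ≤ 4L`, since `δ < 1/2` forces `L ≥ log 2 > 1/2`.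
    have hr8 : (r : ℝ) + 1 ≤ 8 * L := by
      rw [hr', pow_succ]; linarith
    have hi8 : (2 : ℝ) ^ (i + 1) ≤ 8 / Δ := by
      rw [pow_succ]
      calc _ ≤ 4 / Δ * 2 := by gcongr
        _ = 8 / Δ := by ring
    rw [hp]
    push_cast
    calc 2 * ((2 : ℝ) ^ (i + 1) * (r + 1)) ≤ 2 * (8 / Δ * (8 * L)) := by gcongr
      _ = 128 * (1 / Δ * L) := by ring
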